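/- Let $W^o=(W^o(t))_{t\in[0,2\pi]}$ be a Brownian bridge on $[0,2\pi]$, that is, a centred Gaussian process with covariance $\mathbb{E}[W^o(s)W^o(t)]=\min(s,t)-\frac{st}{2\pi}$ and almost surely continuous paths (for example $W^o(t)=B(t)-\frac{t}{2\pi}B(2\pi)$ with $B$ a standard Brownian motion). For $\varphi\in[0,2\pi]$ define the shifted bridge $$W^o_\varphi(\theta)=\begin{cases}W^o(\varphi+\theta)-W^o(\varphi), & 0\le\theta\le 2\pi-\varphi,\\ W^o(\varphi+\theta-2\pi)-W^o(\varphi), & 2\pi-\varphi<\theta\le 2\pi.\end{cases}$$ Then, almost surely, for every $\varphi\in[0,2\pi]$ simultaneously the function $\theta\mapsto W^o_\varphi(\theta)\,\frac{\sin\theta}{1-\cos\theta}$ is Lebesgue integrable on $[0,2\pi]$, so that $$I_\varphi=\int_0^{2\pi}W^o_\varphi(\theta)\,\frac{\sin\theta}{1-\cos\theta}\,d\theta$$ exists and is finite, and the function $\varphi\mapsto I_\varphi$ is continuous on $[0,2\pi]$. -/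

import Mathlib

open MeasureTheory ProbabilityTheory Set

/-- `W` (looked at on `[0, L]` only) is a Brownian bridge of length `L` under `P`: a centred
Gaussian process with covariance `min s t - s t / L` and almost surely continuous paths. -/
structure IsBrownianBridge {Ω : Type*} {mΩ : MeasurableSpace Ω} (L : ℝ) (W : ℝ → Ω → ℝ)
    (P : Measure Ω) : Prop where
  gaussian : IsGaussianProcess (fun t : Icc (0 : ℝ) L => W t) P
  mean : ∀ t ∈ Icc (0 : ℝ) L, ∫ ω, W t ω ∂P = 0
  covariance : ∀ s ∈ Icc (0 : ℝ) L, ∀ t ∈ Icc (0 : ℝ) L,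
    covariance (W s) (W t) P = min s t - s * t / L
  cont : ∀ᵐ ω ∂P, ContinuousOn (fun t => W t ω) (Icc (0 : ℝ) L)

/-- The classical construction: if `B` is a standard Brownian motion, then
`t ↦ B t - (t / L) B L` is a Brownian bridge of length `L`. -/
theorem isBrownianBridge_of_isBrownianReal {Ω : Type*} {mΩ : MeasurableSpace Ω}
    {P : Measure Ω} {B : NNReal → Ω → ℝ} (hB : IsBrownianReal B P) {L : ℝ} (hL : 0 < L) :
    IsBrownianBridge L (fun t ω => B t.toNNReal ω - t / L * B L.toNNReal ω) P := by
  classical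
  have hG := hB.toIsPreBrownianReal.isGaussianProcess
  have hP : IsProbabilityMeasure P := hG.isProbabilityMeasure
  have h2 : ∀ t, MemLp (B t) 2 P := fun t => (hG.hasGaussianLaw_eval t).memLp_two
  have hi : ∀ t, Integrable (B t) P := hB.toIsPreBrownianReal.integrable_eval
  refine ⟨?_, ?_, ?_, ?_⟩
  · refine hG.of_isGaussianProcess fun s => ⟨{(s : ℝ).toNNReal, L.toNNReal},
      ContinuousLinearMap.proj ⟨(s : ℝ).toNNReal, by simp⟩ -
        ((s : ℝ) / L) • ContinuousLinearMap.proj ⟨L.toNNReal, by simp⟩, fun ω => ?_⟩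
    simp
  · intro t _
    rw [integral_sub (hi _) ((hi _).const_mul _), integral_const_mul,
      hB.toIsPreBrownianReal.integral_eval, hB.toIsPreBrownianReal.integral_eval]
    simp
  · intro s hs t ht
    rw [covariance_fun_sub_fun_sub (h2 _) ((h2 _).const_mul _) (h2 _) ((h2 _).const_mul _)]
    simp only [covariance_const_mul_left, covariance_const_mul_right,
      hB.toIsPreBrownianReal.covariance_eval, NNReal.coe_min, Real.coe_toNNReal _ hs.1,
      Real.coe_toNNReal _ ht.1, Real.coe_toNNReal _ hL.le, min_self, min_eq_left hs.2,
      min_eq_right ht.2]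
    field_simp
    ring
  · filter_upwards [hB.cont] with ω hω
    exact (((hω.comp continuous_real_toNNReal).sub
      ((continuous_id.div_const L).mul continuous_const))).continuousOn

/-- The shift by `φ` of a path `w` on `[0, 2π]`, wrapped around at `2π` and recentred. (At
`θ = 2π - φ` the two cases agree as soon as `w 0 = w (2π)`.) -/
noncomputable def bridgeShift (w : ℝ → ℝ) (φ θ : ℝ) : ℝ :=
  if θ ≤ 2 * Real.pi - φ then w (φ + θ) - w φ else w (φ + θ - 2 * Real.pi) - w φ

/-- The integrand of `I_φ`. -/
noncomputable def bridgeIntegrand (w : ℝ → ℝ) (φ θ : ℝ) : ℝ :=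
  bridgeShift w φ θ * (Real.sin θ / (1 - Real.cos θ))

/-- `I_φ`, as a function of the path `w`. -/
noncomputable def bridgeIntegral (w : ℝ → ℝ) (φ : ℝ) : ℝ :=
  ∫ θ in (0 : ℝ)..(2 * Real.pi), bridgeIntegrand w φ θ

/-!
A Brownian bridge on `[0, 2π]` is almost surely a loop, since `W 0 - W (2π)` has variance zero, and
almost surely Hölder continuous. The kernel `sin θ / (1 - cos θ) = cot (θ / 2)` has simple poles at
`0` and `2π` and no other singularity. For a loop `w` that is Hölder continuous with exponent `γ`
and constant `K`, going around the circle in either direction bounds the shift of `w` by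
`2 K min(θ, 2π - θ) ^ γ` (`abs_bridgeShift_le`), whatever the shift `φ`. The integrand is thus
dominated, uniformly in `φ`, by a multiple of `θ ^ (γ - 1) + (2π - θ) ^ (γ - 1)`, which is
integrable. As the integrand is continuous in `φ` for each `θ`, dominated convergence gives both
claims for every such path (`bridgeIntegral_of_holder`).

Hölder continuity comes from Kolmogorov's criterion (`ae_exists_holder_of_moment_le`), applied to
moments of the Gaussian increments, whose variance is at most `|s - t|`
(`IsBrownianBridge.ae_exists_holder`). Since the paths of the bridge are assumed continuous, no
modification has to be constructed: the summability of the moments of the dyadic increments bounds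
these increments almost surely, and chaining along dyadic approximations
(`exists_holder_of_dyadic_increments`) extends the bound to all pairs of points.
-/

/-! ### From dyadic increments to Hölder continuity -/

/-- The dyadic chaining step: each `x` is the limit of its dyadic approximations
`⌊2 ^ n * x⌋ / 2 ^ n`, and consecutive approximations are equal or adjacent on the finer grid. -/
theorem abs_sub_le_of_dyadic_increments {f : ℝ → ℝ} {C r : ℝ} (hC : 0 ≤ C) (hr0 : 0 < r)
    (hr1 : r < 1) (hf : ContinuousOn f (Icc 0 1))
    (hinc : ∀ n k : ℕ, k < 2 ^ n →
      |f (((k : ℝ) + 1) / 2 ^ n) - f ((k : ℝ) / 2 ^ n)| ≤ C * r ^ n)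
    {x : ℝ} (hx : x ∈ Icc (0 : ℝ) 1) (n : ℕ) :
    |f ((⌊2 ^ n * x⌋₊ : ℝ) / 2 ^ n) - f x| ≤ C * r ^ n / (1 - r) := by
  have hle : ∀ m : ℕ, ((⌊2 ^ m * x⌋₊ : ℕ) : ℝ) ≤ 2 ^ m * x := fun m =>
    Nat.floor_le (mul_nonneg (by positivity) hx.1)
  have hlt : ∀ m : ℕ, 2 ^ m * x < ((⌊2 ^ m * x⌋₊ : ℕ) : ℝ) + 1 := fun m => Nat.lt_floor_add_one _
  have hmem : ∀ m : ℕ, ((⌊2 ^ m * x⌋₊ : ℕ) : ℝ) / 2 ^ m ∈ Icc (0 : ℝ) 1 := fun m => by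
    refine ⟨by positivity, ?_⟩
    rw [div_le_one (by positivity)]
    exact (hle m).trans (mul_le_of_le_one_right (by positivity) hx.2)
  have hlim : Filter.Tendsto (fun m : ℕ => ((⌊2 ^ m * x⌋₊ : ℕ) : ℝ) / 2 ^ m) Filter.atTop
      (nhds x) := by
    have h2 : Filter.Tendsto (fun m : ℕ => (2 : ℝ) ^ m) Filter.atTop Filter.atTop :=
      tendsto_pow_atTop_atTop_of_one_lt one_lt_two
    have := (tendsto_nat_floor_mul_div_atTop hx.1).comp h2
    refine this.congr fun m => ?_
    simp [mul_comm]
  have hflim : Filter.Tendsto (fun m : ℕ => f (((⌊2 ^ m * x⌋₊ : ℕ) : ℝ) / 2 ^ m)) Filter.atTop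
      (nhds (f x)) :=
    (hf x hx).tendsto.comp (tendsto_nhdsWithin_iff.2 ⟨hlim, Filter.Eventually.of_forall hmem⟩)
  refine dist_le_of_le_geometric_of_tendsto r C hr1 (fun m => ?_) hflim n
  -- the floor at level `m + 1` is `2 j` or `2 j + 1`, where `j` is the floor at level `m`
  set j := ⌊2 ^ m * x⌋₊ with hj
  set i := ⌊2 ^ (m + 1) * x⌋₊ with hi
  have h1 : 2 * j ≤ i := by
    refine Nat.le_floor ?_
    push_cast
    have := hle m
    rw [pow_succ]
    linarith
  have h2 : i < 2 * j + 2 := by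
    have h3 := hlt m
    have h4 := hle (m + 1)
    rw [pow_succ] at h4
    have : (i : ℝ) < 2 * j + 2 := by
      rw [← hj] at h3
      rw [← pow_succ, ← hi, pow_succ] at h4
      linarith
    exact_mod_cast this
  have hgrid : (j : ℝ) / 2 ^ m = ((2 * j : ℕ) : ℝ) / 2 ^ (m + 1) := by
    push_cast
    rw [pow_succ]
    field_simp
  rw [hgrid, Real.dist_eq]
  obtain h | h : i = 2 * j ∨ i = 2 * j + 1 := by omega
  · rw [h]
    simp only [sub_self, abs_zero]
    positivity
  · have hi' : (i : ℝ) ≤ 2 ^ (m + 1) :=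
      (hle (m + 1)).trans (mul_le_of_le_one_right (by positivity) hx.2)
    have hlt' : 2 * j < 2 ^ (m + 1) := by
      have : i ≤ 2 ^ (m + 1) := by exact_mod_cast hi'
      omega
    rw [h, abs_sub_comm]
    have := hinc (m + 1) (2 * j) hlt'
    push_cast at this ⊢
    refine this.trans (mul_le_mul_of_nonneg_left ?_ hC)
    exact pow_le_pow_of_le_one hr0.le hr1.le (Nat.le_succ m)

/-- A continuous function on `[0, 1]` whose increments over the dyadic intervals of length
`2 ^ (-n)` are at most `C * 2 ^ (-γ n)` is Hölder continuous with exponent `γ`. -/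
theorem exists_holder_of_dyadic_increments {f : ℝ → ℝ} {C γ : ℝ} (hC : 0 ≤ C) (hγ : 0 < γ)
    (hf : ContinuousOn f (Icc 0 1))
    (hinc : ∀ n k : ℕ, k < 2 ^ n →
      |f (((k : ℝ) + 1) / 2 ^ n) - f ((k : ℝ) / 2 ^ n)| ≤ C * ((1 / 2 : ℝ) ^ γ) ^ n) :
    ∃ K, 0 ≤ K ∧ ∀ x ∈ Icc (0 : ℝ) 1, ∀ y ∈ Icc (0 : ℝ) 1, |f x - f y| ≤ K * |x - y| ^ γ := by
  set r : ℝ := (1 / 2 : ℝ) ^ γ with hr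
  have hr0 : 0 < r := by positivity
  have hr1 : r < 1 := Real.rpow_lt_one (by norm_num) (by norm_num) hγ
  have h1r : 0 < 1 - r := by linarith
  have key : ∀ x ∈ Icc (0 : ℝ) 1, ∀ y ∈ Icc (0 : ℝ) 1, x ≤ y → ∀ n : ℕ, y - x ≤ (1 / 2) ^ n →
      |f x - f y| ≤ (C + 2 * (C / (1 - r))) * r ^ n := by
    intro x hx y hy hxy n hn
    have hX := abs_sub_le_of_dyadic_increments hC hr0 hr1 hf hinc hx n
    have hY := abs_sub_le_of_dyadic_increments hC hr0 hr1 hf hinc hy n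
    set i := ⌊2 ^ n * x⌋₊ with hi
    set j := ⌊2 ^ n * y⌋₊ with hj
    -- the floors at level `n` of points at distance at most `2 ^ (-n)` differ by at most one
    have hij : i ≤ j := Nat.floor_le_floor (by gcongr)
    have hji : j < i + 2 := by
      have h1 : (j : ℝ) ≤ 2 ^ n * y := Nat.floor_le (mul_nonneg (by positivity) hy.1)
      have h2 : 2 ^ n * x < (i : ℝ) + 1 := Nat.lt_floor_add_one _
      have h3 : (2 : ℝ) ^ n * (y - x) ≤ 1 := by
        calc (2 : ℝ) ^ n * (y - x) ≤ 2 ^ n * (1 / 2) ^ n := by gcongr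
          _ = 1 := by rw [← mul_pow]; norm_num
      have : (j : ℝ) < i + 2 := by linarith
      exact_mod_cast this
    have hmid : |f ((i : ℝ) / 2 ^ n) - f ((j : ℝ) / 2 ^ n)| ≤ C * r ^ n := by
      obtain h | h : j = i ∨ j = i + 1 := by omega
      · rw [h, sub_self, abs_zero]
        positivity
      · have hj1 : (j : ℝ) ≤ 2 ^ n :=
          (Nat.floor_le (mul_nonneg (by positivity) hy.1)).trans
            (mul_le_of_le_one_right (by positivity) hy.2)
        have hlt : i < 2 ^ n := by
          have : j ≤ 2 ^ n := by exact_mod_cast hj1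
          omega
        have := hinc n i hlt
        rw [h, abs_sub_comm]
        push_cast
        exact this
    have e : (C + 2 * (C / (1 - r))) * r ^ n
        = C * r ^ n / (1 - r) + C * r ^ n + C * r ^ n / (1 - r) := by ring
    rw [e]
    rw [abs_sub_comm] at hX
    calc |f x - f y| ≤ |f x - f (i / 2 ^ n)| + |f (i / 2 ^ n) - f y| := abs_sub_le _ _ _
      _ ≤ |f x - f (i / 2 ^ n)| + (|f (i / 2 ^ n) - f (j / 2 ^ n)| + |f (j / 2 ^ n) - f y|) := by
          gcongr
          exact abs_sub_le _ _ _
      _ ≤ _ := by linarith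
  have key' : ∀ x ∈ Icc (0 : ℝ) 1, ∀ y ∈ Icc (0 : ℝ) 1, x < y →
      |f x - f y| ≤ ((C + 2 * (C / (1 - r))) / r) * |x - y| ^ γ := by
    intro x hx y hy hxy
    obtain ⟨n, hn1, hn2⟩ := exists_nat_pow_near_of_lt_one (sub_pos.2 hxy)
      (by linarith [hx.1, hy.2]) (by norm_num : (0 : ℝ) < 1 / 2) (by norm_num)
    refine (key x hx y hy hxy.le n hn2).trans ?_
    rw [abs_sub_comm, abs_of_pos (sub_pos.2 hxy), div_mul_eq_mul_div, le_div_iff₀ hr0, mul_assoc,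
      ← pow_succ]
    gcongr
    rw [hr, ← Real.rpow_mul_natCast (by norm_num), mul_comm, Real.rpow_natCast_mul (by norm_num)]
    exact Real.rpow_le_rpow (by positivity) hn1.le hγ.le
  refine ⟨(C + 2 * (C / (1 - r))) / r, by positivity, fun x hx y hy => ?_⟩
  rcases lt_trichotomy x y with h | h | h
  · exact key' x hx y hy h
  · subst h
    simp [Real.zero_rpow hγ.ne']
  · rw [abs_sub_comm, abs_sub_comm x y]
    exact key' y hy x hx h

/-! ### Kolmogorov's continuity criterion -/

/-- Kolmogorov's criterion for a process with continuous paths: the `p`-th moments of the dyadic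
increments, weighted by `2 ^ (γ p n)`, have a finite sum, so almost surely the weighted `p`-th
powers themselves are bounded. -/
theorem ae_exists_holder_of_moment_le {Ω : Type*} {mΩ : MeasurableSpace Ω} {P : Measure Ω}
    {X : ℝ → Ω → ℝ} {p q γ M : ℝ} (hp : 0 < p) (hγ : 0 < γ) (hq : γ * p + 1 < q)
    (hmeas : ∀ t ∈ Icc (0 : ℝ) 1, AEMeasurable (X t) P)
    (hmom : ∀ s ∈ Icc (0 : ℝ) 1, ∀ t ∈ Icc (0 : ℝ) 1,
      ∫⁻ ω, ENNReal.ofReal (|X s ω - X t ω| ^ p) ∂P ≤ ENNReal.ofReal (M * |s - t| ^ q))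
    (hcont : ∀ᵐ ω ∂P, ContinuousOn (fun t => X t ω) (Icc 0 1)) :
    ∀ᵐ ω ∂P, ∃ K, 0 ≤ K ∧ ∀ s ∈ Icc (0 : ℝ) 1, ∀ t ∈ Icc (0 : ℝ) 1,
      |X s ω - X t ω| ≤ K * |s - t| ^ γ := by
  set r : ℝ := (1 / 2 : ℝ) ^ γ with hr
  have hr0 : 0 < r := by positivity
  have hrp : ∀ n : ℕ, 0 < (r ^ n) ^ p := fun n => by positivity
  have hmem0 : ∀ n k : ℕ, k < 2 ^ n → (k : ℝ) / 2 ^ n ∈ Icc (0 : ℝ) 1 := fun n k hk => by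
    refine ⟨by positivity, ?_⟩
    rw [div_le_one (by positivity)]
    exact_mod_cast hk.le
  have hmem1 : ∀ n k : ℕ, k < 2 ^ n → ((k : ℝ) + 1) / 2 ^ n ∈ Icc (0 : ℝ) 1 := fun n k hk => by
    refine ⟨by positivity, ?_⟩
    rw [div_le_one (by positivity)]
    exact_mod_cast hk
  let Z : ℕ → ℕ → Ω → ENNReal := fun n k ω =>
    ENNReal.ofReal (((r ^ n) ^ p)⁻¹) *
      ENNReal.ofReal (|X (((k : ℝ) + 1) / 2 ^ n) ω - X ((k : ℝ) / 2 ^ n) ω| ^ p)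
  have hYmeas : ∀ n k : ℕ, k < 2 ^ n → AEMeasurable (fun ω =>
      ENNReal.ofReal (|X (((k : ℝ) + 1) / 2 ^ n) ω - X ((k : ℝ) / 2 ^ n) ω| ^ p)) P := by
    intro n k hk
    have h1 := hmeas _ (hmem1 n k hk)
    have h0 := hmeas _ (hmem0 n k hk)
    exact ((h1.sub h0).abs.pow_const p).ennreal_ofReal
  have hZmeas : ∀ n k : ℕ, k < 2 ^ n → AEMeasurable (Z n k) P := fun n k hk =>
    (hYmeas n k hk).const_mul _
  have hSmeas : ∀ n : ℕ, AEMeasurable (fun ω => ∑ k ∈ Finset.range (2 ^ n), Z n k ω) P :=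
    fun n => Finset.aemeasurable_fun_sum _ fun k hk => hZmeas n k (Finset.mem_range.1 hk)
  -- the ratio of the geometric series that bounds the weighted moments, level by level
  set ρ : ℝ := 2 * (1 / 2 : ℝ) ^ q / r ^ p with hρ
  have hρ0 : 0 ≤ ρ := by positivity
  have hρ1 : ρ < 1 := by
    have h2 : (2 : ℝ) = (1 / 2 : ℝ) ^ (-1 : ℝ) := by
      rw [Real.rpow_neg_one]; norm_num
    rw [hρ, hr, ← Real.rpow_mul (by norm_num), h2]
    norm_num only [← h2]
    rw [div_lt_one (by positivity)]
    calc (2 : ℝ) * (1 / 2) ^ q = (1 / 2 : ℝ) ^ (-1 : ℝ) * (1 / 2) ^ q := by rw [← h2]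
      _ = (1 / 2 : ℝ) ^ (-1 + q) := by rw [Real.rpow_add (by norm_num)]
      _ < (1 / 2 : ℝ) ^ (γ * p) :=
        Real.rpow_lt_rpow_of_exponent_gt (by norm_num) (by norm_num) (by linarith)
  have hlevel : ∀ n : ℕ, ∫⁻ ω, ∑ k ∈ Finset.range (2 ^ n), Z n k ω ∂P
      ≤ ENNReal.ofReal (M * ρ ^ n) := by
    intro n
    rw [lintegral_finsetSum' _ fun k hk => hZmeas n k (Finset.mem_range.1 hk)]
    have hterm : ∀ k ∈ Finset.range (2 ^ n), ∫⁻ ω, Z n k ω ∂P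
        ≤ ENNReal.ofReal (((r ^ n) ^ p)⁻¹ * (M * ((1 / 2) ^ n) ^ q)) := by
      intro k hk
      have hk' := Finset.mem_range.1 hk
      rw [lintegral_const_mul'' _ (hYmeas n k hk'), ENNReal.ofReal_mul (by positivity)]
      gcongr
      refine (hmom _ (hmem1 n k hk') _ (hmem0 n k hk')).trans (le_of_eq ?_)
      congr 3
      rw [← sub_div, add_sub_cancel_left, abs_of_pos (by positivity), one_div_pow]
    refine (Finset.sum_le_card_nsmul _ _ _ hterm).trans (le_of_eq ?_)
    rw [Finset.card_range, nsmul_eq_mul, ← ENNReal.ofReal_natCast,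
      ← ENNReal.ofReal_mul (by positivity)]
    congr 1
    have e1 : ((1 / 2 : ℝ) ^ n) ^ q = ((1 / 2 : ℝ) ^ q) ^ n := by
      rw [← Real.rpow_natCast_mul (by norm_num), ← Real.rpow_mul_natCast (by norm_num), mul_comm]
    have e2 : (r ^ n) ^ p = (r ^ p) ^ n := by
      rw [← Real.rpow_natCast_mul hr0.le, ← Real.rpow_mul_natCast hr0.le, mul_comm]
    rw [e1, e2, hρ, div_pow, mul_pow]
    push_cast
    field_simp
  have hfin : ∫⁻ ω, ∑' n, ∑ k ∈ Finset.range (2 ^ n), Z n k ω ∂P ≠ ⊤ := by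
    rw [lintegral_tsum hSmeas]
    refine ne_top_of_le_ne_top ?_ (ENNReal.tsum_le_tsum hlevel)
    exact ((summable_geometric_of_lt_one hρ0 hρ1).mul_left M).tsum_ofReal_ne_top
  filter_upwards [hcont, ae_lt_top' (AEMeasurable.tsum hSmeas) hfin] with ω hω hS
  set S := ∑' n, ∑ k ∈ Finset.range (2 ^ n), Z n k ω
  refine exists_holder_of_dyadic_increments (C := S.toReal ^ p⁻¹) (by positivity) hγ hω ?_
  intro n k hk
  have hZS : Z n k ω ≤ S :=
    (Finset.single_le_sum (f := fun k => Z n k ω) (fun _ _ => zero_le)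
      (Finset.mem_range.2 hk)).trans (ENNReal.le_tsum n)
  set d := |X (((k : ℝ) + 1) / 2 ^ n) ω - X ((k : ℝ) / 2 ^ n) ω|
  have hd0 : 0 ≤ d := abs_nonneg _
  have h1 : ((r ^ n) ^ p)⁻¹ * d ^ p ≤ S.toReal := by
    have := ENNReal.toReal_mono hS.ne hZS
    simp only [Z] at this
    rwa [← ENNReal.ofReal_mul (by positivity), ENNReal.toReal_ofReal (by positivity)] at this
  rw [inv_mul_le_iff₀ (hrp n)] at h1
  calc d = (d ^ p) ^ p⁻¹ := (Real.rpow_rpow_inv hd0 hp.ne').symm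
    _ ≤ ((r ^ n) ^ p * S.toReal) ^ p⁻¹ := by gcongr
    _ = S.toReal ^ p⁻¹ * r ^ n := by
      rw [Real.mul_rpow (hrp n).le ENNReal.toReal_nonneg, Real.rpow_rpow_inv (by positivity) hp.ne',
        mul_comm]

/-! ### Increments of the Brownian bridge -/

/-- Absolute moments of a centred Gaussian law scale like powers of the standard deviation. -/
theorem lintegral_abs_rpow_gaussianReal (v : NNReal) (p : ℝ) :
    ∫⁻ x, ENNReal.ofReal (|x| ^ p) ∂gaussianReal 0 v =
      ENNReal.ofReal ((v : ℝ) ^ (p / 2)) *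
        ∫⁻ x, ENNReal.ofReal (|x| ^ p) ∂gaussianReal 0 1 := by
  have hv : gaussianReal 0 v = (gaussianReal 0 1).map (Real.sqrt v * ·) := by
    rw [gaussianReal_map_const_mul]
    congr 1
    · simp
    · ext
      simp
  rw [hv, lintegral_map (by fun_prop) (by fun_prop), ← lintegral_const_mul _ (by fun_prop)]
  refine lintegral_congr fun x => ?_
  rw [← ENNReal.ofReal_mul (by positivity), abs_mul, Real.mul_rpow (abs_nonneg _) (abs_nonneg _),
    abs_of_nonneg (Real.sqrt_nonneg _), Real.sqrt_eq_rpow, ← Real.rpow_mul v.coe_nonneg,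
    one_div_mul_eq_div]

theorem lintegral_abs_rpow_gaussianReal_ne_top (v : NNReal) {p : ℝ} (hp : 0 < p) :
    ∫⁻ x, ENNReal.ofReal (|x| ^ p) ∂gaussianReal 0 v ≠ ⊤ := by
  have h := memLp_id_gaussianReal' (μ := 0) (v := v) (ENNReal.ofReal p) ENNReal.ofReal_ne_top
  have h2 := (h.integrable_norm_rpow (by simpa using hp) ENNReal.ofReal_ne_top).lintegral_lt_top
  rw [ENNReal.toReal_ofReal hp.le] at h2
  simpa using h2.ne

namespace IsBrownianBridge

variable {Ω : Type*} {mΩ : MeasurableSpace Ω} {P : Measure Ω} {W : ℝ → Ω → ℝ} {L : ℝ}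

theorem aemeasurable (hW : IsBrownianBridge L W P) {t : ℝ} (ht : t ∈ Icc (0 : ℝ) L) :
    AEMeasurable (W t) P :=
  hW.gaussian.aemeasurable ⟨t, ht⟩

/-- An increment of the bridge is centred Gaussian with variance `|s - t| - (s - t) ^ 2 / L`. -/
theorem map_sub_eq_gaussianReal (hW : IsBrownianBridge L W P) {s t : ℝ}
    (hs : s ∈ Icc (0 : ℝ) L) (ht : t ∈ Icc (0 : ℝ) L) :
    P.map (fun ω => W s ω - W t ω) =
      gaussianReal 0 (|s - t| - (s - t) ^ 2 / L).toNNReal := by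
  have hP : IsProbabilityMeasure P := hW.gaussian.isProbabilityMeasure
  have h2 : ∀ u ∈ Icc (0 : ℝ) L, MemLp (W u) 2 P := fun u hu =>
    (hW.gaussian.hasGaussianLaw_eval ⟨u, hu⟩).memLp_two
  have hlaw : HasGaussianLaw (fun ω => W s ω - W t ω) P :=
    hW.gaussian.hasGaussianLaw_fun_sub (s := ⟨s, hs⟩) (t := ⟨t, ht⟩)
  have hint : ∀ u ∈ Icc (0 : ℝ) L, Integrable (W u) P := fun u hu =>
    (h2 u hu).integrable one_le_two
  rw [hlaw.map_eq_gaussianReal, integral_sub (hint s hs) (hint t ht), hW.mean s hs, hW.mean t ht,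
    sub_zero, variance_fun_sub (h2 s hs) (h2 t ht), ← covariance_self (hW.aemeasurable hs),
    ← covariance_self (hW.aemeasurable ht), hW.covariance s hs s hs, hW.covariance t ht t ht,
    hW.covariance s hs t ht]
  congr 2
  rcases le_total s t with h | h
  · rw [min_self, min_self, min_eq_left h, abs_of_nonpos (by linarith)]
    ring
  · rw [min_self, min_self, min_eq_right h, abs_of_nonneg (by linarith)]
    ring

theorem lintegral_abs_sub_rpow (hW : IsBrownianBridge L W P) {s t p : ℝ}
    (hs : s ∈ Icc (0 : ℝ) L) (ht : t ∈ Icc (0 : ℝ) L) :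
    ∫⁻ ω, ENNReal.ofReal (|W s ω - W t ω| ^ p) ∂P =
      ENNReal.ofReal (((|s - t| - (s - t) ^ 2 / L).toNNReal : ℝ) ^ (p / 2)) *
        ∫⁻ x, ENNReal.ofReal (|x| ^ p) ∂gaussianReal 0 1 := by
  rw [← lintegral_abs_rpow_gaussianReal _ p, ← hW.map_sub_eq_gaussianReal hs ht,
    lintegral_map' (f := fun x => ENNReal.ofReal (|x| ^ p)) (g := fun ω => W s ω - W t ω)
      (by fun_prop) ((hW.aemeasurable hs).sub (hW.aemeasurable ht))]

/-- The variance of `W 0 - W L` vanishes, so the bridge is almost surely a loop. -/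
theorem ae_eq_endpoints (hW : IsBrownianBridge L W P) (hL : 0 < L) :
    ∀ᵐ ω ∂P, W 0 ω = W L ω := by
  have h0 : (0 : ℝ) ∈ Icc (0 : ℝ) L := ⟨le_rfl, hL.le⟩
  have h1 : L ∈ Icc (0 : ℝ) L := ⟨hL.le, le_rfl⟩
  have hv : |0 - L| - (0 - L) ^ 2 / L = 0 := by
    rw [abs_sub_comm, sub_zero, abs_of_pos hL]
    field_simp
    ring
  have h := hW.lintegral_abs_sub_rpow (p := 2) h0 h1
  rw [hv] at h
  norm_num at h
  have hm : AEMeasurable (fun ω => ENNReal.ofReal ((W 0 ω - W L ω) ^ 2)) P :=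
    (((hW.aemeasurable h0).sub (hW.aemeasurable h1)).pow_const 2).ennreal_ofReal
  rw [lintegral_eq_zero_iff' hm] at h
  filter_upwards [h] with ω hω
  simp only [Pi.zero_apply, ENNReal.ofReal_eq_zero] at hω
  exact sub_eq_zero.1 ((pow_eq_zero_iff two_ne_zero).1 (le_antisymm hω (sq_nonneg _)))

/-- Since the increments have standard deviation at most `|s - t| ^ (1 / 2)`, moments of high order
give every Hölder exponent below `1 / 2`. -/
theorem ae_exists_holder (hW : IsBrownianBridge L W P) (hL : 0 < L) {γ : ℝ} (hγ : 0 < γ)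
    (hγ' : γ < 1 / 2) :
    ∀ᵐ ω ∂P, ∃ K, 0 ≤ K ∧ ∀ s ∈ Icc (0 : ℝ) L, ∀ t ∈ Icc (0 : ℝ) L,
      |W s ω - W t ω| ≤ K * |s - t| ^ γ := by
  -- the order of the moments: it satisfies `γ * p + 1 < p / 2`
  obtain ⟨p, hp, hpq⟩ : ∃ p : ℝ, 0 < p ∧ γ * p + 1 < p / 2 := by
    refine ⟨2 / (1 / 2 - γ), div_pos two_pos (by linarith), ?_⟩
    have : (1 / 2 - γ) * (2 / (1 / 2 - γ)) = 2 := mul_div_cancel₀ _ (by linarith)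
    linarith
  have hmul : ∀ t ∈ Icc (0 : ℝ) 1, L * t ∈ Icc (0 : ℝ) L := fun t ht =>
    ⟨mul_nonneg hL.le ht.1, mul_le_of_le_one_right hL.le ht.2⟩
  set m := ∫⁻ x, ENNReal.ofReal (|x| ^ p) ∂gaussianReal 0 1 with hm
  have hm_top : m ≠ ⊤ := lintegral_abs_rpow_gaussianReal_ne_top 1 hp
  have h := ae_exists_holder_of_moment_le (P := P) (X := fun t => W (L * t))
    (M := L ^ (p / 2) * m.toReal) hp hγ hpq
    (fun t ht => hW.aemeasurable (hmul t ht)) (fun s hs t ht => ?_) ?_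
  · filter_upwards [h] with ω ⟨K, hK, hKω⟩
    refine ⟨K * (L ^ γ)⁻¹, by positivity, fun s hs t ht => ?_⟩
    have hdiv : ∀ u ∈ Icc (0 : ℝ) L, u / L ∈ Icc (0 : ℝ) 1 := fun u hu =>
      ⟨div_nonneg hu.1 hL.le, (div_le_one hL).2 hu.2⟩
    have := hKω _ (hdiv s hs) _ (hdiv t ht)
    rw [mul_div_cancel₀ _ hL.ne', mul_div_cancel₀ _ hL.ne', ← sub_div, abs_div, abs_of_pos hL,
      Real.div_rpow (abs_nonneg _) hL.le] at this
    exact this.trans (le_of_eq (by ring))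
  · rw [hW.lintegral_abs_sub_rpow (hmul s hs) (hmul t ht), ← hm,
      ← ENNReal.ofReal_toReal hm_top, ← ENNReal.ofReal_mul (by positivity)]
    refine ENNReal.ofReal_le_ofReal ?_
    have hvar : ((|L * s - L * t| - (L * s - L * t) ^ 2 / L).toNNReal : ℝ) ≤ L * |s - t| := by
      rw [Real.coe_toNNReal', ← mul_sub, abs_mul, abs_of_pos hL]
      have : 0 ≤ (L * (s - t)) ^ 2 / L := by positivity
      exact max_le (by linarith) (by positivity)
    calc _ ≤ (L * |s - t|) ^ (p / 2) * m.toReal := by gcongr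
      _ = _ := by
        rw [Real.mul_rpow hL.le (abs_nonneg _), ENNReal.toReal_ofReal ENNReal.toReal_nonneg]
        ring
  · filter_upwards [hW.cont] with ω hω
    exact hω.comp (by fun_prop) hmul

end IsBrownianBridge

/-! ### The integral of a Hölder continuous loop -/

/-- The kernel is `cot (θ / 2)`, and its only singularities on `[0, 2π]` are simple poles at the
endpoints. -/
theorem abs_sin_div_one_sub_cos_le {θ : ℝ} (h0 : 0 < θ) (h1 : θ < 2 * Real.pi) :
    |Real.sin θ / (1 - Real.cos θ)| ≤ Real.pi / min θ (2 * Real.pi - θ) := by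
  have hpi := Real.pi_pos
  obtain ⟨x, rfl⟩ : ∃ x, θ = 2 * x := ⟨θ / 2, by ring⟩
  have hx0 : 0 < x := by linarith
  have hx1 : x < Real.pi := by linarith
  have hs : 0 < Real.sin x := Real.sin_pos_of_pos_of_lt_pi hx0 hx1
  have hkernel : Real.sin (2 * x) / (1 - Real.cos (2 * x)) = Real.cos x / Real.sin x := by
    have : 1 - Real.cos (2 * x) = 2 * Real.sin x * Real.sin x := by
      rw [Real.cos_two_mul, Real.cos_sq']
      ring
    rw [this, Real.sin_two_mul, mul_div_mul_left _ _ (by positivity)]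
  have hm : 0 < min (2 * x) (2 * Real.pi - 2 * x) := lt_min h0 (by linarith)
  -- Jordan's inequality, at `x` or at `π - x`
  have hjordan : min (2 * x) (2 * Real.pi - 2 * x) ≤ Real.pi * Real.sin x := by
    rcases le_total x (Real.pi / 2) with h | h
    · refine (min_le_left _ _).trans ?_
      have := Real.mul_le_sin hx0.le h
      rw [div_mul_eq_mul_div, div_le_iff₀ hpi] at this
      linarith
    · refine (min_le_right _ _).trans ?_
      have := Real.mul_le_sin (x := Real.pi - x) (by linarith) (by linarith)
      rw [Real.sin_pi_sub, div_mul_eq_mul_div, div_le_iff₀ hpi] at this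
      linarith
  rw [hkernel, abs_div, abs_of_pos hs, div_le_div_iff₀ hs hm]
  calc |Real.cos x| * min (2 * x) (2 * Real.pi - 2 * x)
      ≤ 1 * (Real.pi * Real.sin x) := by
        gcongr
        exact Real.abs_cos_le_one x
    _ = _ := one_mul _

/-- The loop `w` on `[0, 2π]`, run through twice: meaningful on `[0, 4π]`, which contains `φ + θ` for
all `φ, θ ∈ [0, 2π]`. -/
noncomputable def loopExtension (w : ℝ → ℝ) (u : ℝ) : ℝ :=
  if u ≤ 2 * Real.pi then w u else w (u - 2 * Real.pi)

theorem bridgeShift_eq_loopExtension (w : ℝ → ℝ) (φ θ : ℝ) :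
    bridgeShift w φ θ = loopExtension w (φ + θ) - w φ := by
  simp only [bridgeShift, loopExtension, le_sub_iff_add_le, add_comm θ φ]
  split_ifs <;> rfl

theorem continuousOn_loopExtension {w : ℝ → ℝ} (hw : ContinuousOn w (Icc 0 (2 * Real.pi)))
    (hloop : w 0 = w (2 * Real.pi)) :
    ContinuousOn (loopExtension w) (Icc 0 (4 * Real.pi)) := by
  have hpi := Real.pi_pos
  have h1 : ContinuousOn (loopExtension w) (Icc 0 (2 * Real.pi)) :=
    hw.congr fun u hu => if_pos hu.2
  have h2 : ContinuousOn (loopExtension w) (Icc (2 * Real.pi) (4 * Real.pi)) := by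
    have h3 : ContinuousOn (fun u => w (u - 2 * Real.pi)) (Icc (2 * Real.pi) (4 * Real.pi)) :=
      hw.comp (by fun_prop) fun u hu => ⟨by linarith [hu.1], by linarith [hu.2]⟩
    refine h3.congr fun u hu => ?_
    rcases hu.1.eq_or_lt with h | h
    · simp [loopExtension, ← h, hloop]
    · exact if_neg h.not_ge
  rw [← Icc_union_Icc_eq_Icc (by linarith : (0 : ℝ) ≤ 2 * Real.pi) (by linarith)]
  exact h1.union_of_isClosed h2 isClosed_Icc isClosed_Icc

theorem abs_bridgeShift_le {w : ℝ → ℝ} {K γ : ℝ} (hK : 0 ≤ K) (hγ : 0 ≤ γ)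
    (hw : ∀ s ∈ Icc (0 : ℝ) (2 * Real.pi), ∀ t ∈ Icc (0 : ℝ) (2 * Real.pi),
      |w s - w t| ≤ K * |s - t| ^ γ)
    (hloop : w 0 = w (2 * Real.pi)) {φ θ : ℝ} (hφ : φ ∈ Icc (0 : ℝ) (2 * Real.pi))
    (hθ : θ ∈ Icc (0 : ℝ) (2 * Real.pi)) :
    |bridgeShift w φ θ| ≤ 2 * K * min θ (2 * Real.pi - θ) ^ γ := by
  have hpi := Real.pi_pos
  set L := 2 * Real.pi with hL
  have h0 : (0 : ℝ) ∈ Icc (0 : ℝ) L := ⟨le_rfl, by linarith⟩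
  have h1 : L ∈ Icc (0 : ℝ) L := ⟨by linarith, le_rfl⟩
  have hw' : ∀ s ∈ Icc (0 : ℝ) L, ∀ t ∈ Icc (0 : ℝ) L, ∀ d, |s - t| ≤ d →
      |w s - w t| ≤ K * d ^ γ := fun s hs t ht d hd =>
    (hw s hs t ht).trans (by gcongr)
  -- the two points of a shift are compared through `0 = L` if the arc between them contains it
  have hvia : ∀ s ∈ Icc (0 : ℝ) L, ∀ t ∈ Icc (0 : ℝ) L, ∀ d, s ≤ d → L - t ≤ d →
      |w s - w t| ≤ 2 * K * d ^ γ := fun s hs t ht d hsd htd => by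
    have ha := hw' s hs 0 h0 d (by rw [sub_zero, abs_of_nonneg hs.1]; exact hsd)
    have hb := hw' L h1 t ht d (by rw [abs_of_nonneg (by linarith [ht.2])]; exact htd)
    rw [hloop] at ha
    calc |w s - w t| ≤ |w s - w L| + |w L - w t| := abs_sub_le _ _ _
      _ ≤ 2 * K * d ^ γ := by linarith
  have hdirect : ∀ s ∈ Icc (0 : ℝ) L, ∀ t ∈ Icc (0 : ℝ) L, ∀ d, |s - t| ≤ d →
      |w s - w t| ≤ 2 * K * d ^ γ := fun s hs t ht d hd => by
    have hd0 : 0 ≤ d := (abs_nonneg _).trans hd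
    have : 0 ≤ K * d ^ γ := by positivity
    linarith [hw' s hs t ht d hd]
  unfold bridgeShift
  rcases min_cases θ (L - θ) with ⟨hm, _⟩ | ⟨hm, _⟩ <;> rw [hm] <;> split_ifs with hc
  · exact hdirect _ ⟨by linarith [hφ.1, hθ.1], by linarith⟩ _ hφ _
      (by rw [add_sub_cancel_left, abs_of_nonneg hθ.1])
  · exact hvia _ ⟨by linarith [not_le.1 hc], by linarith [hφ.2, hθ.2]⟩ _ hφ _
      (by linarith [hφ.2]) (by linarith [not_le.1 hc])
  · rw [abs_sub_comm]
    exact hvia _ hφ _ ⟨by linarith [hφ.1, hθ.1], by linarith⟩ _ (by linarith) (by linarith [hφ.1])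
  · refine hdirect _ ⟨by linarith [not_le.1 hc], by linarith [hφ.2, hθ.2]⟩ _ hφ _ ?_
    rw [abs_of_nonpos (by linarith [hθ.2])]
    linarith

/-- The bound on the integrand that is uniform in `φ`. -/
theorem abs_bridgeIntegrand_le {w : ℝ → ℝ} {K γ : ℝ} (hK : 0 ≤ K) (hγ : 0 ≤ γ)
    (hw : ∀ s ∈ Icc (0 : ℝ) (2 * Real.pi), ∀ t ∈ Icc (0 : ℝ) (2 * Real.pi),
      |w s - w t| ≤ K * |s - t| ^ γ)
    (hloop : w 0 = w (2 * Real.pi)) {φ θ : ℝ} (hφ : φ ∈ Icc (0 : ℝ) (2 * Real.pi))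
    (hθ : θ ∈ Ioo (0 : ℝ) (2 * Real.pi)) :
    |bridgeIntegrand w φ θ| ≤
      2 * K * Real.pi * (θ ^ (γ - 1) + (2 * Real.pi - θ) ^ (γ - 1)) := by
  have hpi := Real.pi_pos
  have hθ' : 0 < 2 * Real.pi - θ := by linarith [hθ.2]
  have hm : 0 < min θ (2 * Real.pi - θ) := lt_min hθ.1 hθ'
  have hsum : min θ (2 * Real.pi - θ) ^ (γ - 1) ≤ θ ^ (γ - 1) + (2 * Real.pi - θ) ^ (γ - 1) := by
    have ha : 0 ≤ θ ^ (γ - 1) := Real.rpow_nonneg hθ.1.le _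
    have hb : 0 ≤ (2 * Real.pi - θ) ^ (γ - 1) := Real.rpow_nonneg hθ'.le _
    rcases min_choice θ (2 * Real.pi - θ) with h | h <;> rw [h] <;> linarith
  rw [bridgeIntegrand, abs_mul]
  calc |bridgeShift w φ θ| * |Real.sin θ / (1 - Real.cos θ)|
      ≤ (2 * K * min θ (2 * Real.pi - θ) ^ γ) * (Real.pi / min θ (2 * Real.pi - θ)) :=
        mul_le_mul (abs_bridgeShift_le hK hγ hw hloop hφ ⟨hθ.1.le, hθ.2.le⟩)
          (abs_sin_div_one_sub_cos_le hθ.1 hθ.2) (abs_nonneg _) (by positivity)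
    _ = 2 * K * Real.pi * min θ (2 * Real.pi - θ) ^ (γ - 1) := by
        rw [Real.rpow_sub_one hm.ne']
        ring
    _ ≤ _ := by gcongr

theorem intervalIntegrable_rpow_add_rpow_sub {γ : ℝ} (hγ : 0 < γ) (c L : ℝ) :
    IntervalIntegrable (fun θ => c * (θ ^ (γ - 1) + (L - θ) ^ (γ - 1))) volume 0 L := by
  have h : IntervalIntegrable (fun θ : ℝ => θ ^ (γ - 1)) volume 0 L :=
    intervalIntegral.intervalIntegrable_rpow' (by linarith)
  have h' := (h.comp_sub_left L).symm
  rw [sub_zero, sub_self] at h'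
  exact (h.add h').const_mul c

/-- A Hölder modulus of continuity compensates the poles of the kernel uniformly in `φ`, so
dominated convergence applies. -/
theorem bridgeIntegral_of_holder {w : ℝ → ℝ} {K γ : ℝ} (hK : 0 ≤ K) (hγ : 0 < γ)
    (hcont : ContinuousOn w (Icc 0 (2 * Real.pi)))
    (hw : ∀ s ∈ Icc (0 : ℝ) (2 * Real.pi), ∀ t ∈ Icc (0 : ℝ) (2 * Real.pi),
      |w s - w t| ≤ K * |s - t| ^ γ)
    (hloop : w 0 = w (2 * Real.pi)) :
    (∀ φ ∈ Icc (0 : ℝ) (2 * Real.pi),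
        IntervalIntegrable (bridgeIntegrand w φ) volume 0 (2 * Real.pi)) ∧
      ContinuousOn (bridgeIntegral w) (Icc (0 : ℝ) (2 * Real.pi)) := by
  have hpi := Real.pi_pos
  have hL : (0 : ℝ) ≤ 2 * Real.pi := by linarith
  have hext := continuousOn_loopExtension hcont hloop
  have hker : Measurable fun θ : ℝ => Real.sin θ / (1 - Real.cos θ) := by fun_prop
  have hmeas : ∀ φ ∈ Icc (0 : ℝ) (2 * Real.pi), AEStronglyMeasurable (bridgeIntegrand w φ)
      (volume.restrict (uIoc 0 (2 * Real.pi))) := fun φ hφ => by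
    have h : ContinuousOn (bridgeShift w φ) (Icc 0 (2 * Real.pi)) := by
      simp only [funext (bridgeShift_eq_loopExtension w φ)]
      exact (hext.comp (by fun_prop) fun θ hθ =>
        ⟨by linarith [hθ.1, hφ.1], by linarith [hθ.2, hφ.2]⟩).sub continuousOn_const
    rw [uIoc_of_le hL]
    exact ((h.mono Ioc_subset_Icc_self).aestronglyMeasurable measurableSet_Ioc).mul
      hker.aestronglyMeasurable
  have hbound : ∀ φ ∈ Icc (0 : ℝ) (2 * Real.pi), ∀ᵐ θ, θ ∈ uIoc 0 (2 * Real.pi) →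
      ‖bridgeIntegrand w φ θ‖ ≤
        2 * K * Real.pi * (θ ^ (γ - 1) + (2 * Real.pi - θ) ^ (γ - 1)) := fun φ hφ => by
    filter_upwards [Measure.ae_ne volume (2 * Real.pi)] with θ hne hθ
    rw [uIoc_of_le hL] at hθ
    exact abs_bridgeIntegrand_le hK hγ.le hw hloop hφ ⟨hθ.1, lt_of_le_of_ne hθ.2 hne⟩
  have hint := intervalIntegrable_rpow_add_rpow_sub hγ (2 * K * Real.pi) (2 * Real.pi)
  refine ⟨fun φ hφ => hint.mono_fun (hmeas φ hφ) ?_, fun φ hφ => ?_⟩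
  · filter_upwards [(ae_restrict_iff' measurableSet_uIoc).2 (hbound φ hφ)] with θ hθ
    exact hθ.trans (le_abs_self _)
  · refine intervalIntegral.continuousWithinAt_of_dominated_interval
      (Filter.eventually_of_mem self_mem_nhdsWithin hmeas)
      (Filter.eventually_of_mem self_mem_nhdsWithin hbound) hint
      (Filter.Eventually.of_forall fun θ hθ => ?_)
    rw [uIoc_of_le hL] at hθ
    simp only [bridgeIntegrand, bridgeShift_eq_loopExtension]
    have h : ContinuousOn (fun φ => loopExtension w (φ + θ)) (Icc 0 (2 * Real.pi)) :=
      hext.comp (by fun_prop) fun φ hφ => ⟨by linarith [hθ.1, hφ.1], by linarith [hθ.2, hφ.2]⟩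
    exact ((h.sub hcont).mul continuousOn_const) φ hφ

/-! ### Integrability and continuity for the Brownian bridge -/

theorem mainTheorem5 {Ω : Type*} {mΩ : MeasurableSpace Ω} (P : Measure Ω)
    [IsProbabilityMeasure P] (W : ℝ → Ω → ℝ) (hW : IsBrownianBridge (2 * Real.pi) W P) :
    ∀ᵐ ω ∂P,
      (∀ φ ∈ Icc (0 : ℝ) (2 * Real.pi),
        IntervalIntegrable (bridgeIntegrand (fun t => W t ω) φ) volume 0 (2 * Real.pi)) ∧
      ContinuousOn (bridgeIntegral (fun t => W t ω)) (Icc (0 : ℝ) (2 * Real.pi)) := by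
  have hL : (0 : ℝ) < 2 * Real.pi := Real.two_pi_pos
  filter_upwards [hW.cont, hW.ae_eq_endpoints hL,
    hW.ae_exists_holder hL (γ := 1 / 4) (by norm_num) (by norm_num)] with ω hcont hloop ⟨K, hK, hw⟩
  exact bridgeIntegral_of_holder hK (by norm_num : (0 : ℝ) < 1 / 4) hcont hw hloop
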